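/- Let $(X,d)$ be a compact metric space and let $f:X\to X$ be a continuous map with finite topological entropy. Let $\mathcal M$ be the set of $f$-invariant Borel probability measures on $X$ with the weak$^*$ topology, and let $h_\mu(f)$ denote the measure-theoretic entropy of $\mu\in\mathcal M$; assume that $\mu\mapsto h_\mu(f)$ is upper semicontinuous on $\mathcal M$. For a continuous $\varphi:X\to\mathbb R$ let $ES(\varphi)$ be the set of equilibrium states of $\varphi$, i.e. of those $\mu\in\mathcal M$ with $h_\mu(f)+\int\varphi\,d\mu=\sup_{\nu\in\mathcal M}\left(h_\nu(f)+\int\varphi\,d\nu\right)$. A measure $\mu\in\mathcal M$ is a ground state of $\varphi$ if there are an increasing sequence of real numbers $t_n\to\infty$ and $\mu_n\in ES(t_n\varphi)$ with $\mu_n\to\mu$. Let $\Phi=(\phi_1,\dots,\phi_m):X\to\mathbb R^m$ be continuous, let ${\rm rv}(\mu)=\left(\int\phi_1\,d\mu,\dots,\int\phi_m\,d\mu\right)$ be the rotation vector of $\mu\in\mathcal M$, and let ${\rm Rot}(\Phi)=\{{\rm rv}(\mu):\mu\in\mathcal M\}$. Let $\alpha\in\mathbb R^m$ be a direction vector, i.e.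 $\|\alpha\|=1$ in the Euclidean norm. Let $H_\alpha(\Phi)$ be the supporting hyperplane of ${\rm Rot}(\Phi)$ for which $\alpha$ is the normal vector pointing away from ${\rm Rot}(\Phi)$, let $F_\alpha(\Phi)={\rm Rot}(\Phi)\cap H_\alpha(\Phi)$, and let $GS(\alpha)$ be the set of ground states of $\alpha\cdot\Phi=\alpha_1\phi_1+\dots+\alpha_m\phi_m$. Then: (a) If $\mu\in GS(\alpha)$, then ${\rm rv}(\mu)\in F_\alpha(\Phi)$ and $h_\mu(f)=\sup\{h_\nu(f):\nu\in\mathcal M,\ {\rm rv}(\nu)\in F_\alpha(\Phi)\}$. (b) The set $\{{\rm rv}(\mu):\mu\in GS(\alpha)\}$ is compact. Further, if there is $t_0\in\mathbb R$ such that for every $t\ge t_0$ the potential $t\,\alpha\cdot\Phi$ has a unique equilibrium state $\mu_t$, and if $t\mapsto{\rm rv}(\mu_t)$ is continuous on $[t_0,\infty)$, then $\{{\rm rv}(\mu):\mu\in GS(\alpha)\}$ is connected. -/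

import Mathlib

open MeasureTheory Filter Topology

noncomputable section

namespace GroundStates

section Dynamics

variable {X : Type*} [MetricSpace X] [CompactSpace X] [MeasurableSpace X] [BorelSpace X]

/-- The space of `f`-invariant Borel probability measures on `X`; as a subtype of
`ProbabilityMeasure X` it carries the weak-star topology. -/
abbrev InvMeasure (f : X → X) : Type _ :=
  {μ : ProbabilityMeasure X // MeasurePreserving f (μ : Measure X) (μ : Measure X)}

/-- The `n`-itinerary of a point with respect to a finite partition, the latter being encoded by
the map `P : X → Fin k` sending a point to the label of its cell. The fibres of `itinerary f P n`
are the cells of the join of the partitions `f⁻ⁱ P`, `0 ≤ i < n`. -/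
def itinerary (f : X → X) {k : ℕ} (P : X → Fin k) (n : ℕ) (x : X) : Fin n → Fin k :=
  fun i => P (f^[(i : ℕ)] x)

/-- The Shannon entropy `-∑ μ(A) log μ(A)` of the join of the partitions `f⁻ⁱ P`, `0 ≤ i < n`. -/
def joinEntropy (f : X → X) (μ : ProbabilityMeasure X) {k : ℕ} (P : X → Fin k) (n : ℕ) : ℝ :=
  ∑ a : Fin n → Fin k, Real.negMulLog ((μ : Measure X).real (itinerary f P n ⁻¹' {a}))

/-- The entropy `h_μ(f, P) = lim (1/n) H_μ(⋁_{i<n} f⁻ⁱ P)` of `f` relative to the partition `P`.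
For invariant `μ` the limit exists, so it agrees with the upper limit used here. -/
def partitionEntropy (f : X → X) (μ : ProbabilityMeasure X) {k : ℕ} (P : X → Fin k) : EReal :=
  limsup (fun n : ℕ => ((joinEntropy f μ P n / n : ℝ) : EReal)) atTop

/-- The measure-theoretic (Kolmogorov-Sinai) entropy `h_μ(f)`: the supremum of `h_μ(f, P)` over
all finite measurable partitions `P`. It may be infinite. -/
def entropy (f : X → X) (μ : InvMeasure f) : EReal :=
  ⨆ (k : ℕ) (P : X → Fin k) (_ : Measurable P), partitionEntropy f μ.1 P

/-- The free energy `h_μ(f) + ∫ φ dμ`. -/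
def freeEnergy (f : X → X) (φ : X → ℝ) (μ : InvMeasure f) : EReal :=
  entropy f μ + ((∫ x, φ x ∂(μ.1 : Measure X) : ℝ) : EReal)

/-- The set of equilibrium states of the potential `φ`. -/
def equilibriumStates (f : X → X) (φ : X → ℝ) : Set (InvMeasure f) :=
  {μ | freeEnergy f φ μ = ⨆ ν : InvMeasure f, freeEnergy f φ ν}

/-- The set of ground states of the potential `φ`: weak-star limits of equilibrium states of
`tₙ φ` for some increasing sequence `tₙ → ∞`. -/
def groundStates (f : X → X) (φ : X → ℝ) : Set (InvMeasure f) :=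
  {μ | ∃ (t : ℕ → ℝ) (ν : ℕ → InvMeasure f), StrictMono t ∧ Tendsto t atTop atTop ∧
    (∀ n, ν n ∈ equilibriumStates f (fun x => t n * φ x)) ∧ Tendsto ν atTop (𝓝 μ)}

variable {m : ℕ}

/-- The rotation vector `(∫ φ₁ dμ, …, ∫ φₘ dμ)` of an invariant measure. -/
def rv {f : X → X} (Φ : C(X, EuclideanSpace ℝ (Fin m))) (μ : InvMeasure f) :
    EuclideanSpace ℝ (Fin m) :=
  WithLp.toLp 2 (fun i => ∫ x, Φ x i ∂(μ.1 : Measure X))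

/-- The generalized rotation set of `Φ`. -/
def rotationSet (f : X → X) (Φ : C(X, EuclideanSpace ℝ (Fin m))) :
    Set (EuclideanSpace ℝ (Fin m)) :=
  Set.range (rv (f := f) Φ)

/-- The one-dimensional potential `α · Φ = α₁ φ₁ + ⋯ + αₘ φₘ`. -/
def dirPotential (α : EuclideanSpace ℝ (Fin m)) (Φ : C(X, EuclideanSpace ℝ (Fin m))) (x : X) : ℝ :=
  ∑ i, α i * Φ x i

end Dynamics

section Convex

variable {m : ℕ}

/-- The hyperplane `{u : u · α = a}`. -/
def hyperplane (α : EuclideanSpace ℝ (Fin m)) (a : ℝ) : Set (EuclideanSpace ℝ (Fin m)) :=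
  {u | inner ℝ α u = a}

/-- The hyperplane `{u : u · α = a}` cuts `K`: both its open half spaces contain points of `K`. -/
def Cuts (K : Set (EuclideanSpace ℝ (Fin m))) (α : EuclideanSpace ℝ (Fin m)) (a : ℝ) : Prop :=
  (∃ v ∈ K, inner ℝ α v < a) ∧ ∃ v ∈ K, a < inner ℝ α v

/-- The hyperplane `{u : u · α = a}` is a supporting hyperplane of `K`: its distance to `K` is
zero, but it does not cut `K`. -/
def IsSupporting (K : Set (EuclideanSpace ℝ (Fin m))) (α : EuclideanSpace ℝ (Fin m)) (a : ℝ) :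
    Prop :=
  (∀ ε > 0, ∃ v ∈ K, ∃ w ∈ hyperplane α a, dist v w < ε) ∧ ¬ Cuts K α a

/-- The normal vector `α` of the hyperplane `{u : u · α = a}` points away from `K`: the open
half space into which `α` points contains no point of `K`. -/
def PointsAway (K : Set (EuclideanSpace ℝ (Fin m))) (α : EuclideanSpace ℝ (Fin m)) (a : ℝ) : Prop :=
  ∀ v ∈ K, ¬ a < inner ℝ α v

/-- The supporting hyperplane of `K` for which `α` is the normal vector pointing away from `K`,
as the set of all points `u` such that the hyperplane through `u` normal to `α` has this
property. (For compact non-empty `K` and `α ≠ 0` there is exactly one such hyperplane.) -/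
def supportingHyperplane (K : Set (EuclideanSpace ℝ (Fin m))) (α : EuclideanSpace ℝ (Fin m)) :
    Set (EuclideanSpace ℝ (Fin m)) :=
  {u | IsSupporting K α (inner ℝ α u) ∧ PointsAway K α (inner ℝ α u)}

end Convex

/-- The face `F_α(Φ) = Rot(Φ) ∩ H_α(Φ)` of the rotation set. -/
def face {X : Type*} [MetricSpace X] [CompactSpace X] [MeasurableSpace X] [BorelSpace X] {m : ℕ}
    (f : X → X) (Φ : C(X, EuclideanSpace ℝ (Fin m))) (α : EuclideanSpace ℝ (Fin m)) :
    Set (EuclideanSpace ℝ (Fin m)) :=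
  rotationSet f Φ ∩ supportingHyperplane (rotationSet f Φ) α

end GroundStates

end

namespace GroundStates

open MeasureTheory Filter Topology

/-! ### A uniform entropy bound from finite topological entropy. -/

section Entropy

/-! Let `φ = α · Φ`. An equilibrium state `σ` of `t φ` satisfies `h_ν + t ∫ φ dν ≤ h_σ + t ∫ φ dσ`
for all invariant `ν`. If entropies lie in `[0, C]`, dividing by `t → ∞` shows that ground states
maximise `∫ φ`, that is, lie over the face. If `ν` already lies over the face, the energy terms can
be dropped and `h_ν ≤ h_σ`, which upper semicontinuity carries to the limit.

The constant `C` comes from `entropy_le_coverEntropy_add`: words are coded by a mixture of product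
weights centred on a dynamical cover. An additive error is harmless here, as any uniform bound will
do.

Ground states form `⋂ T, closure (⋃ t ≥ T, ES(t φ))`, closed in a compact space, which gives
compactness. For a continuous curve of rotation vectors the image is a nested intersection of
compact connected sets. -/

/-- **Gibbs' inequality**. -/
theorem sum_negMulLog_le_neg_sum_mul_log {ι : Type*} [Fintype ι] {p q : ι → ℝ}
    (hp : ∀ i, 0 ≤ p i) (hq : ∀ i, 0 < q i) (hp1 : ∑ i, p i = 1) (hq1 : ∑ i, q i ≤ 1) :
    ∑ i, Real.negMulLog (p i) ≤ ∑ i, p i * (-Real.log (q i)) := by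
  have key : ∀ i, Real.negMulLog (p i) ≤ p i * (-Real.log (q i)) + (q i - p i) := by
    intro i
    rcases (hp i).eq_or_lt with h | h
    · simp [← h, (hq i).le]
    · have h1 := Real.log_le_sub_one_of_pos (div_pos (hq i) h)
      rw [Real.log_div (hq i).ne' h.ne'] at h1
      have h2 := mul_le_mul_of_nonneg_left h1 h.le
      have h3 : p i * (q i / p i - 1) = q i - p i := by field_simp
      rw [Real.negMulLog]
      linarith
  calc ∑ i, Real.negMulLog (p i) ≤ ∑ i, (p i * (-Real.log (q i)) + (q i - p i)) :=
        Finset.sum_le_sum fun i _ => key i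
    _ = ∑ i, p i * (-Real.log (q i)) + (∑ i, q i - ∑ i, p i) := by
        rw [Finset.sum_add_distrib, Finset.sum_sub_distrib]
    _ ≤ _ := by linarith

/-- A probability vector on `Fin k` giving mass at least `1 / 2` to `j` and at least `1 / (2 * k)`
to every point. -/
noncomputable def biasedWeight {k : ℕ} (j a : Fin k) : ℝ :=
  (if a = j then 1 / 2 else 0) + 1 / (2 * k)

theorem sum_biasedWeight {k : ℕ} (j : Fin k) : ∑ a, biasedWeight j a = 1 := by
  have hk : (k : ℝ) ≠ 0 := by
    have := j.pos
    positivity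
  simp only [biasedWeight, Finset.sum_add_distrib, Finset.sum_ite_eq', Finset.mem_univ, if_true,
    Finset.sum_const, Finset.card_univ, Fintype.card_fin, nsmul_eq_mul]
  field_simp
  norm_num

theorem biasedWeight_pos {k : ℕ} (j a : Fin k) : 0 < biasedWeight j a := by
  have : (0 : ℝ) < k := by exact_mod_cast j.pos
  unfold biasedWeight
  split_ifs <;> positivity

/-- Code length of a letter `a` when `j` is guessed: `log 2` for a right guess, an extra `log k` for
a wrong one. -/
theorem neg_log_biasedWeight_le {k : ℕ} (j a : Fin k) :
    -Real.log (biasedWeight j a) ≤ Real.log 2 + (if a = j then 0 else Real.log k) := by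
  have hk : (0 : ℝ) < k := by exact_mod_cast j.pos
  rw [neg_le]
  split_ifs with h
  · rw [add_zero, ← Real.log_inv]
    refine Real.log_le_log (by norm_num) ?_
    have : (0 : ℝ) ≤ 1 / (2 * k) := by positivity
    simp only [biasedWeight, h, if_true]
    linarith
  · rw [← Real.log_mul two_ne_zero hk.ne', ← Real.log_inv]
    simp [biasedWeight, h]

variable {X : Type*} [MeasurableSpace X]

theorem measurable_itinerary {f : X → X} (hf : Measurable f) {k : ℕ} {P : X → Fin k}
    (hP : Measurable P) (n : ℕ) : Measurable (itinerary f P n) :=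
  measurable_pi_lambda _ fun i => hP.comp (hf.iterate i)

theorem joinEntropy_nonneg (f : X → X) (μ : ProbabilityMeasure X) {k : ℕ} (P : X → Fin k) (n : ℕ) :
    0 ≤ joinEntropy f μ P n :=
  Finset.sum_nonneg fun _ _ => Real.negMulLog_nonneg measureReal_nonneg measureReal_le_one

/-- The Shannon entropy of a join is bounded by the mean code length of any subprobability vector
on words. -/
theorem joinEntropy_le_integral {f : X → X} (hf : Measurable f) (μ : ProbabilityMeasure X) {k : ℕ}
    {P : X → Fin k} (hP : Measurable P) {n : ℕ} {q : (Fin n → Fin k) → ℝ} (hq : ∀ a, 0 < q a)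
    (hq1 : ∑ a, q a ≤ 1) :
    joinEntropy f μ P n ≤ ∫ x, -Real.log (q (itinerary f P n x)) ∂(μ : Measure X) := by
  have hm := measurable_itinerary hf hP n
  have := Measure.isProbabilityMeasure_map (μ := (μ : Measure X)) hm.aemeasurable
  have hr : ∀ a, (μ : Measure X).real (itinerary f P n ⁻¹' {a}) =
      ((μ : Measure X).map (itinerary f P n)).real {a} := fun a =>
    (map_measureReal_apply hm (measurableSet_singleton a)).symm
  rw [← integral_map (f := fun a => -Real.log (q a)) hm.aemeasurable
    (measurable_of_finite fun a => -Real.log (q a)).aestronglyMeasurable, integral_fintype .of_finite, joinEntropy]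
  simp only [hr, smul_eq_mul]
  refine sum_negMulLog_le_neg_sum_mul_log (fun _ => measureReal_nonneg) hq ?_ hq1
  rw [sum_measureReal_singleton]
  simp

theorem entropy_nonneg (f : X → X) (μ : InvMeasure f) : 0 ≤ entropy f μ := by
  have h : (0 : EReal) ≤ partitionEntropy f μ.1 (fun _ => (0 : Fin 1)) := by
    refine le_limsup_of_frequently_le (Frequently.of_forall fun n => ?_)
    have := joinEntropy_nonneg f μ.1 (fun _ => (0 : Fin 1)) n
    exact_mod_cast (by positivity : 0 ≤ joinEntropy f μ.1 (fun _ => (0 : Fin 1)) n / (n : ℝ))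
  exact h.trans (le_iSup_of_le 1 (le_iSup₂_of_le _ measurable_const le_rfl))

/-- The entropy of the `n`-th join in terms of the size of a dynamical cover. -/
theorem joinEntropy_le_of_isDynCoverOf {f : X → X} (hf : Measurable f) (μ : ProbabilityMeasure X)
    (hμ : MeasurePreserving f (μ : Measure X) (μ : Measure X)) {k : ℕ} {P : X → Fin k}
    (hP : Measurable P) {B : Set X} (hB : MeasurableSet B) {U : SetRel X X} {j : X → Fin k}
    (hj : ∀ x y, (x, y) ∈ U → x ∉ B → P x = j y) {n : ℕ} {S : Finset X}
    (hS : Dynamics.IsDynCoverOf f Set.univ U n (S : Set X)) :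
    joinEntropy f μ P n ≤
      Real.log S.card + n * (Real.log 2 + Real.log k * (μ : Measure X).real B) := by
  obtain ⟨x₀⟩ : Nonempty X := nonempty_of_isProbabilityMeasure (μ : Measure X)
  have hSne : S.Nonempty := by
    obtain ⟨y, hy, -⟩ := hS (Set.mem_univ x₀)
    exact ⟨y, hy⟩
  have hN : (0 : ℝ) < S.card := by exact_mod_cast hSne.card_pos
  have hlogk : 0 ≤ Real.log k := Real.log_natCast_nonneg k
  -- `w s` guesses each letter from the orbit of `s`. Averaging over the centres in `S` costs at
  -- most `log S.card`, and wrong guesses occur only on visits to `B`.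
  set w : X → (Fin n → Fin k) → ℝ := fun s a => ∏ i : Fin n, biasedWeight (j (f^[(i : ℕ)] s)) (a i) with hw
  have hwpos : ∀ s a, 0 < w s a := fun s a => Finset.prod_pos fun i _ => biasedWeight_pos _ _
  have hwsum : ∀ s, ∑ a, w s a = 1 := by
    intro s
    simp only [hw]
    rw [← Fintype.prod_sum]
    simp [sum_biasedWeight]
  set q : (Fin n → Fin k) → ℝ := fun a => (∑ s ∈ S, w s a) / S.card with hq
  have hqpos : ∀ a, 0 < q a := fun a => div_pos (Finset.sum_pos (fun s _ => hwpos s a) hSne) hN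
  have hqsum : ∑ a, q a ≤ 1 := by
    simp only [hq]
    rw [← Finset.sum_div, Finset.sum_comm]
    simp [hwsum, hN.ne']
  have hpt : ∀ x, -Real.log (q (itinerary f P n x)) ≤ Real.log S.card +
      ∑ i : Fin n, (Real.log 2 + Real.log k * (f^[(i : ℕ)] ⁻¹' B).indicator 1 x) := by
    intro x
    obtain ⟨s, hs, hxs⟩ := hS (Set.mem_univ x)
    have hxs' := Dynamics.mem_dynEntourage.1 hxs
    have h1 : w s (itinerary f P n x) / S.card ≤ q (itinerary f P n x) := by
      simp only [hq]
      gcongr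
      exact Finset.single_le_sum (f := fun s => w s (itinerary f P n x))
        (fun s _ => (hwpos s _).le) hs
    have h2 := Real.log_le_log (div_pos (hwpos s _) hN) h1
    rw [Real.log_div (hwpos s _).ne' hN.ne'] at h2
    have h3 : -Real.log (w s (itinerary f P n x)) ≤
        ∑ i : Fin n, (Real.log 2 + Real.log k * (f^[(i : ℕ)] ⁻¹' B).indicator 1 x) := by
      simp only [hw]
      rw [Real.log_prod (fun i _ => (biasedWeight_pos _ _).ne'), ← Finset.sum_neg_distrib]
      refine Finset.sum_le_sum fun i _ => (neg_log_biasedWeight_le _ _).trans ?_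
      by_cases hb : f^[(i : ℕ)] x ∈ B
      · have : (f^[(i : ℕ)] ⁻¹' B).indicator (1 : X → ℝ) x = 1 := Set.indicator_of_mem (Set.mem_preimage.2 hb) _
        rw [this]
        split_ifs <;> linarith
      · have h : itinerary f P n x i = j (f^[(i : ℕ)] s) := hj _ _ (hxs' i i.2) hb
        have : (f^[(i : ℕ)] ⁻¹' B).indicator (1 : X → ℝ) x = 0 := Set.indicator_of_notMem (mt Set.mem_preimage.1 hb) _
        rw [if_pos h, this]
        simp
    linarith
  have hBi : ∀ i : ℕ, MeasurableSet (f^[i] ⁻¹' B) := fun i => (hf.iterate i) hB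
  have hind : ∀ i : ℕ, Integrable (fun x => Real.log 2 + Real.log k *
      (f^[i] ⁻¹' B).indicator (1 : X → ℝ) x) (μ : Measure X) := fun i =>
    (integrable_const _).add (((integrable_const (1 : ℝ)).indicator (hBi i)).const_mul _)
  have hint : ∀ i : ℕ, ∫ x, (Real.log 2 + Real.log k *
      (f^[i] ⁻¹' B).indicator (1 : X → ℝ) x) ∂(μ : Measure X) =
      Real.log 2 + Real.log k * (μ : Measure X).real B := by
    intro i
    have hone : Integrable ((f^[i] ⁻¹' B).indicator (1 : X → ℝ)) (μ : Measure X) :=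
      (integrable_const (1 : ℝ)).indicator (hBi i)
    rw [integral_add (integrable_const _) (hone.const_mul _), integral_const_mul,
      integral_indicator_one (hBi i),
      measureReal_def, (hμ.iterate i).measure_preimage hB.nullMeasurableSet, ← measureReal_def]
    simp
  have hm := measurable_itinerary hf hP n
  calc joinEntropy f μ P n ≤ ∫ x, -Real.log (q (itinerary f P n x)) ∂(μ : Measure X) :=
        joinEntropy_le_integral hf μ hP hqpos hqsum
    _ ≤ ∫ x, (Real.log S.card +
        ∑ i : Fin n, (Real.log 2 + Real.log k * (f^[(i : ℕ)] ⁻¹' B).indicator 1 x))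
          ∂(μ : Measure X) := by
        refine integral_mono ?_ ((integrable_const _).add
          (integrable_finsetSum _ fun (i : Fin n) _ => hind i)) hpt
        exact (Integrable.of_finite (f := fun a => -Real.log (q a))
          (μ := (μ : Measure X).map (itinerary f P n))).comp_measurable hm
    _ = _ := by
        rw [integral_add (integrable_const _) (integrable_finsetSum _ fun (i : Fin n) _ => hind i),
          integral_finsetSum _ fun (i : Fin n) _ => hind i]
        simp only [hint]
        simp [mul_add]

variable [MetricSpace X] [CompactSpace X] [BorelSpace X]

/-- Up to a set of small measure, the cell of a point is determined by any nearby point. -/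
theorem exists_label_of_measurable (μ : ProbabilityMeasure X) {k : ℕ} {P : X → Fin k}
    (hP : Measurable P) {ε : ℝ} (hε : 0 < ε) :
    ∃ B : Set X, MeasurableSet B ∧ (μ : Measure X).real B ≤ ε ∧ ∃ U ∈ uniformity X,
      ∃ j : X → Fin k, ∀ x y, (x, y) ∈ U → x ∉ B → P x = j y := by
  -- Inner regularity: `P` is uniformly locally constant on the union of finitely many disjoint
  -- compact sets, and `B` is the complement of that union.
  have hF : ∀ i : Fin k, ∃ F ⊆ P ⁻¹' {i}, IsClosed F ∧
      (μ : Measure X) (P ⁻¹' {i} \ F) < ENNReal.ofReal (ε / k) := fun i =>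
    (hP (measurableSet_singleton i)).exists_isClosed_sdiff_lt (measure_ne_top _ _)
      (by
        have : 0 < k := i.pos
        simpa using by positivity)
  choose F hFP hFc hFμ using hF
  have hFm : ∀ i x, x ∈ F i → P x = i := fun i x hx => hFP i hx
  have hGc : IsClosed (⋃ i, F i) := isClosed_iUnion_of_finite hFc
  refine ⟨(⋃ i, F i)ᶜ, hGc.measurableSet.compl, ?_, ?_⟩
  · have h1 : (⋃ i, F i)ᶜ ⊆ ⋃ i, (P ⁻¹' {i} \ F i) := fun x hx => by
      simp only [Set.mem_compl_iff, Set.mem_iUnion, not_exists] at hx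
      exact Set.mem_iUnion.2 ⟨P x, rfl, hx _⟩
    calc (μ : Measure X).real (⋃ i, F i)ᶜ ≤ (μ : Measure X).real (⋃ i, (P ⁻¹' {i} \ F i)) :=
          measureReal_mono h1
      _ ≤ ∑ i, (μ : Measure X).real (P ⁻¹' {i} \ F i) := measureReal_iUnion_fintype_le _
      _ ≤ ∑ i : Fin k, ε / k := Finset.sum_le_sum fun i _ =>
          ENNReal.toReal_le_of_le_ofReal (by positivity) (hFμ i).le
      _ ≤ ε := by
          rcases Nat.eq_zero_or_pos k with rfl | hk
          · simpa using hε.le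
          · have : (0 : ℝ) < k := by exact_mod_cast hk
            rw [Finset.sum_const, Finset.card_univ, Fintype.card_fin, nsmul_eq_mul]
            field_simp
            rfl
  · have hcont : ContinuousOn (fun x => ((P x : ℕ) : ℝ)) (⋃ i, F i) := by
      have : ContinuousOn P (⋃ i, F i) := by
        refine continuousOn_iff_isClosed.2 fun t _ =>
          ⟨⋃ i ∈ t, F i, t.toFinite.isClosed_biUnion fun i _ => hFc i, ?_⟩
        ext x
        simp only [Set.mem_inter_iff, Set.mem_preimage, Set.mem_iUnion, exists_prop]
        constructor
        · rintro ⟨h, i, hi⟩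
          exact ⟨⟨i, hFm i x hi ▸ h, hi⟩, i, hi⟩
        · rintro ⟨⟨i, hit, hi⟩, h⟩
          exact ⟨hFm i x hi ▸ hit, h⟩
      exact (continuous_of_discreteTopology (f := fun i : Fin k => ((i : ℕ) : ℝ))).comp_continuousOn
        this
    have hu := hGc.isCompact.uniformContinuousOn_of_continuous hcont
    obtain ⟨δ, hδ, hd⟩ := Metric.uniformContinuousOn_iff.1 hu 1 one_pos
    have hd' : ∀ x ∈ ⋃ i, F i, ∀ y ∈ ⋃ i, F i, dist x y < δ → P x = P y := by
      intro x hx y hy hxy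
      have h := hd x hx y hy hxy
      rw [Nat.dist_cast_real, Nat.dist_eq] at h
      have h' : |((P x : ℕ) : ℤ) - (P y : ℕ)| < 1 := by exact_mod_cast h
      rw [Int.abs_lt_one_iff] at h'
      exact Fin.ext (by omega)
    -- The centre `y` may lie in `B`; with radius `δ / 2`, any two good points near `y` are within
    -- `δ` of each other and share a label.
    refine ⟨{p | dist p.1 p.2 < δ / 2}, Metric.dist_mem_uniformity (half_pos hδ), ?_⟩
    have hj : ∀ y, ∃ i : Fin k, ∀ x ∈ ⋃ i, F i, dist x y < δ / 2 → P x = i := by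
      intro y
      by_cases h : ∃ z ∈ ⋃ i, F i, dist z y < δ / 2
      · obtain ⟨z, hz, hzy⟩ := h
        refine ⟨P z, fun x hx hxy => hd' x hx z hz ?_⟩
        have := dist_triangle_right x z y
        linarith
      · exact ⟨P y, fun x hx hxy => absurd ⟨x, hx, hxy⟩ h⟩
    choose j hj using hj
    exact ⟨j, fun x y hxy hx => hj y x (not_not.1 hx) hxy⟩

theorem partitionEntropy_le_coverEntropy_add {f : X → X} (hf : Continuous f) (μ : InvMeasure f)
    {k : ℕ} {P : X → Fin k} (hP : Measurable P) :
    partitionEntropy f μ.1 P ≤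
      Dynamics.coverEntropy f Set.univ + ((Real.log 2 + 1 : ℝ) : EReal) := by
  obtain ⟨x₀⟩ : Nonempty X := nonempty_of_isProbabilityMeasure (μ.1 : Measure X)
  have hlogk : 0 ≤ Real.log k := Real.log_natCast_nonneg k
  -- This `ε` makes the cost `log k * μ(B)` at most `1`, so the final constant does not depend on
  -- `P`.
  obtain ⟨B, hB, hBε, U, hU, j, hj⟩ :=
    exists_label_of_measurable μ.1 hP (ε := 1 / (Real.log k + 1)) (by positivity)
  have hkB : Real.log k * (μ.1 : Measure X).real B ≤ 1 := by
    calc Real.log k * (μ.1 : Measure X).real B ≤ Real.log k * (1 / (Real.log k + 1)) := by gcongr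
      _ ≤ 1 := by
        rw [mul_one_div, div_le_one (by positivity)]
        linarith
  have hle : ∀ᶠ n : ℕ in atTop, ((joinEntropy f μ.1 P n / n : ℝ) : EReal) ≤
      ENNReal.log (Dynamics.coverMincard f Set.univ U n : ENNReal) / (n : EReal) +
        ((Real.log 2 + 1 : ℝ) : EReal) := by
    filter_upwards [eventually_gt_atTop 0] with n hn
    have hfin := Dynamics.coverMincard_finite_of_isCompact_invariant (T := f) isCompact_univ
      (Set.mapsTo_univ f Set.univ) hU n
    obtain ⟨S, hS, hcard⟩ := (Dynamics.coverMincard_finite_iff f Set.univ U n).1 hfin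
    have hN : 0 < S.card := by
      obtain ⟨y, hy, -⟩ := hS (Set.mem_univ x₀)
      exact Finset.card_pos.2 ⟨y, hy⟩
    have hn' : (0 : ℝ) < n := by exact_mod_cast hn
    have h := joinEntropy_le_of_isDynCoverOf hf.measurable μ.1 μ.2 hP hB hj hS
    have hreal : joinEntropy f μ.1 P n / n ≤ Real.log S.card / n + (Real.log 2 + 1) := by
      rw [div_add' _ _ _ hn'.ne']
      gcongr
      nlinarith
    have hlog : ENNReal.log (Dynamics.coverMincard f Set.univ U n : ENNReal) =
        ((Real.log S.card : ℝ) : EReal) := by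
      rw [← hcard, ENat.toENNReal_coe, ENNReal.log_pos_real (by exact_mod_cast hN.ne')
        (ENNReal.natCast_ne_top _), ENNReal.toReal_natCast]
    rw [hlog, ← EReal.coe_natCast, ← EReal.coe_div, ← EReal.coe_add]
    exact_mod_cast hreal
  refine (limsup_le_limsup hle).trans ?_
  refine (EReal.limsup_add_le (.inr (by rw [limsup_const]; exact EReal.coe_ne_top _))
    (.inr (by rw [limsup_const]; exact EReal.coe_ne_bot _))).trans ?_
  rw [limsup_const]
  refine add_le_add_left ?_ _
  exact Dynamics.coverEntropyEntourage_le_coverEntropy f Set.univ hU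

/-- A weak form of **Goodwyn's theorem**. -/
theorem entropy_le_coverEntropy_add {f : X → X} (hf : Continuous f) (μ : InvMeasure f) :
    entropy f μ ≤ Dynamics.coverEntropy f Set.univ + ((Real.log 2 + 1 : ℝ) : EReal) :=
  iSup_le fun _ => iSup₂_le fun _ hP => partitionEntropy_le_coverEntropy_add hf μ hP

theorem exists_real_entropy_le {f : X → X} (hf : Continuous f)
    (htop : Dynamics.coverEntropy f Set.univ < ⊤) :
    ∃ C : ℝ, ∀ μ : InvMeasure f, entropy f μ ≤ (C : EReal) := by
  obtain ⟨C, hC⟩ : ∃ C : ℝ, Dynamics.coverEntropy f Set.univ ≤ (C : EReal) :=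
    ⟨_, EReal.le_coe_toReal htop.ne⟩
  refine ⟨C + (Real.log 2 + 1), fun μ => (entropy_le_coverEntropy_add hf μ).trans ?_⟩
  rw [EReal.coe_add]
  exact add_le_add_left hC _

end Entropy

/-! ### Topological tools and the variational inequality. -/

section Limits

/-- A decreasing intersection of compact preconnected sets is preconnected. -/
theorem isPreconnected_iInter_of_directed {Y ι : Type*} [TopologicalSpace Y] [T2Space Y]
    [Nonempty ι] {K : ι → Set Y} (hd : Directed (· ⊇ ·) K) (hc : ∀ i, IsCompact (K i))
    (hK : ∀ i, IsPreconnected (K i)) : IsPreconnected (⋂ i, K i) := by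
  have hcl : IsClosed (⋂ i, K i) := isClosed_iInter fun i => (hc i).isClosed
  have hcomp : IsCompact (⋂ i, K i) :=
    (hc (Classical.arbitrary ι)).of_isClosed_subset hcl (Set.iInter_subset _ _)
  refine (isPreconnected_iff_subset_of_fully_disjoint_closed hcl).2 fun u v hu hv huv hdisj => ?_
  -- By compactness some `K i` already lies in `U ∪ V`, hence in one of the two.
  obtain ⟨U, V, hU, hV, huU, hvV, hUV⟩ := SeparatedNhds.of_isCompact_isCompact
    (hcomp.inter_right hu) (hcomp.inter_right hv) (hdisj.mono Set.inter_subset_right Set.inter_subset_right)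
  obtain ⟨i, hi⟩ := exists_subset_nhds_of_isCompact hd hc (U := U ∪ V) fun x hx =>
    (hU.union hV).mem_nhds ((huv hx).imp (fun h => huU ⟨hx, h⟩) fun h => hvV ⟨hx, h⟩)
  rcases (hK i).subset_or_subset hU hV hUV hi with h | h
  · refine .inl fun x hx => (huv hx).resolve_right fun hxv => ?_
    exact hUV.le_bot ⟨h (Set.iInter_subset _ _ hx), hvV ⟨hx, hxv⟩⟩
  · refine .inr fun x hx => (huv hx).resolve_left fun hxu => ?_
    exact hUV.le_bot ⟨huU ⟨hx, hxu⟩, h (Set.iInter_subset _ _ hx)⟩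

variable {X : Type*} [MeasurableSpace X]

/-- The variational inequality satisfied by an equilibrium state of `t φ`, in real numbers. -/
theorem entropy_toReal_add_le {f : X → X} {C : ℝ}
    (h0 : ∀ μ : InvMeasure f, 0 ≤ entropy f μ) (hC : ∀ μ : InvMeasure f, entropy f μ ≤ (C : EReal))
    {φ : X → ℝ} {t : ℝ} {μ : InvMeasure f} (hμ : μ ∈ equilibriumStates f fun x => t * φ x)
    (ν : InvMeasure f) :
    (entropy f ν).toReal + t * ∫ x, φ x ∂(ν.1 : Measure X) ≤
      (entropy f μ).toReal + t * ∫ x, φ x ∂(μ.1 : Measure X) := by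
  have hr : ∀ μ : InvMeasure f, entropy f μ = (((entropy f μ).toReal : ℝ) : EReal) := fun μ =>
    (EReal.coe_toReal (ne_top_of_le_ne_top (EReal.coe_ne_top C) (hC μ))
      (ne_bot_of_le_ne_bot EReal.zero_ne_bot (h0 μ))).symm
  have h : freeEnergy f (fun x => t * φ x) ν ≤ freeEnergy f (fun x => t * φ x) μ := by
    rw [show freeEnergy f (fun x => t * φ x) μ = _ from hμ]
    exact le_iSup (freeEnergy f fun x => t * φ x) ν
  simp only [freeEnergy, integral_const_mul] at h
  rw [hr μ, hr ν] at h
  exact_mod_cast h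

variable [MetricSpace X] [CompactSpace X] [BorelSpace X]

/-- Invariant measures are the fixed points of the weak-star continuous push-forward, a closed set
in a compact space. -/
theorem compactSpace_invMeasure {f : X → X} (hf : Continuous f) :
    CompactSpace (InvMeasure f) := by
  have h : {μ : ProbabilityMeasure X | MeasurePreserving f (μ : Measure X) (μ : Measure X)} =
      {μ | μ.map hf.measurable.aemeasurable = μ} := by
    ext μ
    constructor
    · intro h
      exact Subtype.ext h.map_eq
    · intro h
      exact ⟨hf.measurable, congrArg Subtype.val h⟩
  have hc : IsClosed {μ : ProbabilityMeasure X |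
      MeasurePreserving f (μ : Measure X) (μ : Measure X)} := by
    rw [h]
    exact isClosed_eq (ProbabilityMeasure.continuous_map hf) continuous_id
  exact isCompact_iff_compactSpace.1 hc.isCompact

variable {m : ℕ}

theorem continuous_rv (f : X → X) (Φ : C(X, EuclideanSpace ℝ (Fin m))) :
    Continuous (rv (f := f) Φ) := by
  refine (PiLp.continuous_toLp 2 _).comp (continuous_pi fun i => ?_)
  exact (ProbabilityMeasure.continuous_iff_forall_continuousMap_continuous_integral.1
    (continuous_subtype_val (p := fun μ : ProbabilityMeasure X =>
      MeasurePreserving f (μ : Measure X) (μ : Measure X))))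
    ⟨fun x => Φ x i, by fun_prop⟩

theorem integral_dirPotential {f : X → X} (α : EuclideanSpace ℝ (Fin m))
    (Φ : C(X, EuclideanSpace ℝ (Fin m))) (μ : InvMeasure f) :
    ∫ x, dirPotential α Φ x ∂(μ.1 : Measure X) = inner ℝ α (rv Φ μ) := by
  have hi : ∀ i, Integrable (fun x => α i * Φ x i) (μ.1 : Measure X) := fun i =>
    (by fun_prop : Continuous fun x => α i * Φ x i).integrable_of_hasCompactSupport
      (HasCompactSupport.of_compactSpace _)
  simp only [dirPotential]
  rw [integral_finsetSum _ fun i _ => hi i]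
  simp [PiLp.inner_apply, rv, integral_const_mul, mul_comm]

/-! ### Ground states as a limit set. -/

/-- Ground states are the limit points, as `t → ∞`, of the equilibrium states of `t φ`. -/
theorem groundStates_eq_iInter_closure (f : X → X) (φ : X → ℝ) :
    groundStates f φ =
      ⋂ T : ℝ, closure (⋃ t ≥ T, equilibriumStates f fun x => t * φ x) := by
  ext μ
  simp only [Set.mem_iInter]
  constructor
  · rintro ⟨t, ν, -, ht, hν, hlim⟩ T
    refine mem_closure_of_tendsto hlim ?_
    filter_upwards [ht.eventually_ge_atTop T] with n hn
    exact Set.mem_iUnion₂.2 ⟨t n, hn, hν n⟩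
  · intro h
    have : FirstCountableTopology (InvMeasure f) :=
      (Topology.IsInducing.subtypeVal (Y := ProbabilityMeasure X)).firstCountableTopology
    obtain ⟨V, hV⟩ := (𝓝 μ).exists_antitone_basis
    have hex : ∀ (n : ℕ) (T : ℝ), ∃ t : ℝ, ∃ ν : InvMeasure f, T ≤ t ∧ ν ∈ V n ∧
        ν ∈ equilibriumStates f fun x => t * φ x := by
      intro n T
      obtain ⟨ν, hνV, hν⟩ := mem_closure_iff_nhds.1 (h T) _ (hV.mem n)
      obtain ⟨t, ht, hνt⟩ := Set.mem_iUnion₂.1 hν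
      exact ⟨t, ν, ht, hνV, hνt⟩
    choose τ σ hτ hσV hσ using hex
    -- Lower bounds for the times: each exceeds the previous time by `1`, so the times increase
    -- strictly to infinity.
    let p : ℕ → ℝ := fun n => Nat.rec 0 (fun n T => τ n T + 1) n
    have hp : ∀ n, p (n + 1) = τ n (p n) + 1 := fun _ => rfl
    have hpn : ∀ n : ℕ, (n : ℝ) ≤ p n := by
      intro n
      induction n with
      | zero => simp [p]
      | succ n ih =>
        rw [hp, Nat.cast_succ]
        linarith [hτ n (p n)]
    refine ⟨fun n => τ n (p n), fun n => σ n (p n), strictMono_nat_of_lt_succ fun n => ?_, ?_,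
      fun n => hσ _ _, hV.tendsto fun n => hσV _ _⟩
    · linarith [hτ (n + 1) (p (n + 1)), hp n]
    · exact tendsto_atTop_mono (fun n => (hpn n).trans (hτ n _)) tendsto_natCast_atTop_atTop

theorem isClosed_groundStates (f : X → X) (φ : X → ℝ) : IsClosed (groundStates f φ) := by
  rw [groundStates_eq_iInter_closure]
  exact isClosed_iInter fun _ => isClosed_closure

theorem isCompact_rv_image_groundStates {f : X → X} (hf : Continuous f)
    (Φ : C(X, EuclideanSpace ℝ (Fin m))) (φ : X → ℝ) :
    IsCompact (rv Φ '' groundStates f φ) :=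
  have := compactSpace_invMeasure hf
  (isClosed_groundStates f φ).isCompact.image (continuous_rv f Φ)

/-! ### Ground states lie over the face and maximise entropy there. -/

theorem mem_face_iff {f : X → X} {Φ : C(X, EuclideanSpace ℝ (Fin m))}
    {α : EuclideanSpace ℝ (Fin m)} {μ : InvMeasure f} :
    rv Φ μ ∈ face f Φ α ↔ ∀ ν : InvMeasure f, inner ℝ α (rv Φ ν) ≤ inner ℝ α (rv Φ μ) := by
  constructor
  · rintro ⟨-, -, h⟩ ν
    exact not_lt.1 (h _ ⟨ν, rfl⟩)
  · intro h
    refine ⟨⟨μ, rfl⟩, ⟨fun ε hε => ⟨_, ⟨μ, rfl⟩, _, rfl, by simpa using hε⟩, ?_⟩, ?_⟩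
    · rintro ⟨-, -, ⟨ν, rfl⟩, hν⟩
      exact hν.not_ge (h ν)
    · rintro - ⟨ν, rfl⟩
      exact (h ν).not_gt

theorem rv_mem_face_of_mem_groundStates {f : X → X} {C : ℝ}
    (h0 : ∀ μ : InvMeasure f, 0 ≤ entropy f μ) (hC : ∀ μ : InvMeasure f, entropy f μ ≤ (C : EReal))
    (Φ : C(X, EuclideanSpace ℝ (Fin m))) (α : EuclideanSpace ℝ (Fin m)) {μ : InvMeasure f}
    (hμ : μ ∈ groundStates f (dirPotential α Φ)) : rv Φ μ ∈ face f Φ α := by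
  obtain ⟨t, σ, -, ht, hσ, hlim⟩ := hμ
  refine mem_face_iff.2 fun ν => ?_
  have h1 : Tendsto (fun n => inner ℝ α (rv Φ (σ n))) atTop (𝓝 (inner ℝ α (rv Φ μ))) :=
    (((continuous_const.inner continuous_id).comp (continuous_rv f Φ)).tendsto μ).comp hlim
  have h2 : Tendsto (fun n => C / t n + inner ℝ α (rv Φ (σ n))) atTop
      (𝓝 (0 + inner ℝ α (rv Φ μ))) := (ht.const_div_atTop C).add h1
  rw [zero_add] at h2
  refine ge_of_tendsto h2 ?_
  filter_upwards [ht.eventually_gt_atTop 0] with n hn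
  have h := entropy_toReal_add_le h0 hC (hσ n) ν
  rw [integral_dirPotential, integral_dirPotential] at h
  have h3 : 0 ≤ (entropy f ν).toReal := EReal.toReal_nonneg (h0 ν)
  have h4 : (entropy f (σ n)).toReal ≤ C :=
    EReal.toReal_le_toReal (hC _) (ne_bot_of_le_ne_bot EReal.zero_ne_bot (h0 _))
      (EReal.coe_ne_top C)
  rw [div_add' _ _ _ hn.ne', le_div_iff₀ hn]
  linarith

theorem entropy_le_of_mem_groundStates {f : X → X} {C : ℝ}
    (h0 : ∀ μ : InvMeasure f, 0 ≤ entropy f μ) (hC : ∀ μ : InvMeasure f, entropy f μ ≤ (C : EReal))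
    (husc : UpperSemicontinuous (entropy f)) (Φ : C(X, EuclideanSpace ℝ (Fin m)))
    (α : EuclideanSpace ℝ (Fin m)) {μ : InvMeasure f}
    (hμ : μ ∈ groundStates f (dirPotential α Φ)) {ν : InvMeasure f} (hν : rv Φ ν ∈ face f Φ α) :
    entropy f ν ≤ entropy f μ := by
  obtain ⟨t, σ, -, ht, hσ, hlim⟩ := hμ
  by_contra! hlt
  -- If `h_μ < h_ν`, upper semicontinuity gives `h_(σ n) < h_ν` for large `n`, against the
  -- variational inequality.
  obtain ⟨n, hn, htn⟩ := ((hlim.eventually (husc μ _ hlt)).and (ht.eventually_ge_atTop 0)).exists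
  have h := entropy_toReal_add_le h0 hC (hσ n) ν
  rw [integral_dirPotential, integral_dirPotential] at h
  have h1 := mul_le_mul_of_nonneg_left (mem_face_iff.1 hν (σ n)) htn
  have h2 : (entropy f ν).toReal ≤ (entropy f (σ n)).toReal := by linarith
  refine hn.not_ge ?_
  rw [← EReal.coe_toReal (ne_top_of_le_ne_top (EReal.coe_ne_top C) (hC ν))
      (ne_bot_of_le_ne_bot EReal.zero_ne_bot (h0 ν)),
    ← EReal.coe_toReal (ne_top_of_le_ne_top (EReal.coe_ne_top C) (hC (σ n)))
      (ne_bot_of_le_ne_bot EReal.zero_ne_bot (h0 (σ n)))]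
  exact_mod_cast h2

/-! ### Connectedness. -/

theorem isConnected_rv_image_groundStates {f : X → X} (hf : Continuous f)
    (Φ : C(X, EuclideanSpace ℝ (Fin m))) (φ : X → ℝ) {t₀ : ℝ} {μ : ℝ → InvMeasure f}
    (hμ : ∀ t ≥ t₀, equilibriumStates f (fun x => t * φ x) = {μ t})
    (hcont : ContinuousOn (fun t => rv Φ (μ t)) (Set.Ici t₀)) :
    IsConnected (rv Φ '' groundStates f φ) := by
  have := compactSpace_invMeasure hf
  have hrv := continuous_rv f Φ
  let K : Set.Ici t₀ → Set (InvMeasure f) := fun T => closure (μ '' Set.Ici (T : ℝ))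
  have hK : ∀ T, IsCompact (K T) := fun T => isClosed_closure.isCompact
  have hanti : Antitone K := fun S T h => closure_mono (Set.image_mono (Set.Ici_subset_Ici.2 h))
  have hdir : Directed (· ⊇ ·) K := hanti.directed_ge
  have hGS : groundStates f φ = ⋂ T, K T := by
    have hT : ∀ T ≥ t₀, (⋃ t ≥ T, equilibriumStates f fun x => t * φ x) = μ '' Set.Ici T := by
      intro T hT
      ext ν
      simp only [Set.mem_iUnion, Set.mem_image, Set.mem_Ici, exists_prop]
      refine exists_congr fun t => and_congr_right fun ht => ?_
      rw [hμ t (hT.trans ht), Set.mem_singleton_iff, eq_comm]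
    rw [groundStates_eq_iInter_closure]
    refine (Set.subset_iInter fun T => ?_).antisymm (Set.subset_iInter fun T => ?_)
    · exact (Set.iInter_subset _ (T : ℝ)).trans (closure_mono (hT T T.2).le)
    · refine (Set.iInter_subset K ⟨max T t₀, le_max_right T t₀⟩).trans ?_
      simp only [K]
      rw [← hT _ (le_max_right _ _)]
      exact closure_mono (Set.iUnion₂_mono' fun t ht => ⟨t, (le_max_left _ _).trans ht, subset_rfl⟩)
  have hne : (⋂ T, K T).Nonempty :=
    IsCompact.nonempty_iInter_of_directed_nonempty_isCompact_isClosed K hdir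
      (fun T => ⟨μ T, subset_closure ⟨T, Set.self_mem_Ici, rfl⟩⟩) hK fun T => isClosed_closure
  -- Only `rv Φ ∘ μ` is assumed continuous, so connectedness is available after applying `rv Φ`;
  -- compactness of the fibres in `K T` lets the image pass through the intersection.
  have himg : rv Φ '' (⋂ T, K T) = ⋂ T, rv Φ '' K T := by
    refine (Set.image_iInter_subset _ _).antisymm fun v hv => ?_
    rw [Set.mem_iInter] at hv
    have hcl : IsClosed (rv (f := f) Φ ⁻¹' {v}) := isClosed_singleton.preimage hrv
    obtain ⟨ν, hν⟩ := IsCompact.nonempty_iInter_of_directed_nonempty_isCompact_isClosed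
      (fun T => K T ∩ rv Φ ⁻¹' {v})
      (Antitone.directed_ge fun S T h => Set.inter_subset_inter_left _ (hanti h))
      (fun T => by
        obtain ⟨ν, hν, hv⟩ := hv T
        exact ⟨ν, hν, hv⟩)
      (fun T => (hK T).inter_right hcl) (fun T => isClosed_closure.inter hcl)
    rw [Set.mem_iInter] at hν
    exact ⟨ν, Set.mem_iInter.2 fun T => (hν T).1, (hν ⟨t₀, Set.self_mem_Ici⟩).2⟩
  rw [hGS]
  refine ⟨hne.image _, ?_⟩
  rw [himg]
  refine isPreconnected_iInter_of_directed
    (Antitone.directed_ge fun S T h => Set.image_mono (hanti h)) (fun T => (hK T).image hrv)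
    fun T => ?_
  have hpre : IsPreconnected (rv Φ '' (μ '' Set.Ici (T : ℝ))) := by
    rw [Set.image_image]
    exact isPreconnected_Ici.image _ (hcont.mono (Set.Ici_subset_Ici.2 T.2))
  -- The image of `K T` lies between a connected curve and its closure.
  exact hpre.subset_closure (Set.image_mono subset_closure) (image_closure_subset_closure_image hrv)

end Limits
end GroundStates

theorem theorem1 {X : Type*} [MetricSpace X] [CompactSpace X] [MeasurableSpace X] [BorelSpace X]
    (f : X → X) (hf : Continuous f)
    (htop : Dynamics.coverEntropy f Set.univ < ⊤)
    (husc : UpperSemicontinuous (GroundStates.entropy f))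
    {m : ℕ} (Φ : C(X, EuclideanSpace ℝ (Fin m)))
    (α : EuclideanSpace ℝ (Fin m)) (hα : ‖α‖ = 1) :
    (∀ μ ∈ GroundStates.groundStates f (GroundStates.dirPotential α Φ),
      GroundStates.rv Φ μ ∈ GroundStates.face f Φ α ∧
      GroundStates.entropy f μ =
        sSup (GroundStates.entropy f ''
          {ν : GroundStates.InvMeasure f | GroundStates.rv Φ ν ∈ GroundStates.face f Φ α})) ∧
    IsCompact (GroundStates.rv Φ ''
      GroundStates.groundStates f (GroundStates.dirPotential α Φ)) ∧
    (∀ (t₀ : ℝ) (μ : ℝ → GroundStates.InvMeasure f),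
      (∀ t ≥ t₀, GroundStates.equilibriumStates f
        (fun x => t * GroundStates.dirPotential α Φ x) = {μ t}) →
      ContinuousOn (fun t => GroundStates.rv Φ (μ t)) (Set.Ici t₀) →
      IsConnected (GroundStates.rv Φ ''
        GroundStates.groundStates f (GroundStates.dirPotential α Φ))) := by
  have h0 := GroundStates.entropy_nonneg f
  obtain ⟨C, hC⟩ := GroundStates.exists_real_entropy_le hf htop
  have hface : ∀ μ ∈ GroundStates.groundStates f (GroundStates.dirPotential α Φ),
      GroundStates.rv Φ μ ∈ GroundStates.face f Φ α := fun μ hμ =>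
    GroundStates.rv_mem_face_of_mem_groundStates h0 hC Φ α hμ
  refine ⟨fun μ hμ => ⟨hface μ hμ, le_antisymm (le_sSup ⟨μ, hface μ hμ, rfl⟩) (sSup_le ?_)⟩,
    GroundStates.isCompact_rv_image_groundStates hf Φ _, fun t₀ μ hμ hcont =>
    GroundStates.isConnected_rv_image_groundStates hf Φ _ hμ hcont⟩
  rintro - ⟨ν, hν, rfl⟩
  exact GroundStates.entropy_le_of_mem_groundStates h0 hC husc Φ α hμ hν
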